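/- In the Joint Replenishment Problem with Deadlines, an instance consists of a number $m$ of retailers, a warehouse ordering cost $C\in\mathbb{Q}_{\ge 0}$, retailer ordering costs $c_1,\dots,c_m\in\mathbb{Q}_{\ge 0}$, and a finite set $\mathcal{D}$ of demands $(\rho,r,d)$, where $\rho\in\{1,\dots,m\}$ is a retailer and $1\le r\le d$ are integers (release time and deadline); $[r,d]$ is the demand period. A schedule is a finite set of orders $(t,R)$ with $t\in\mathbb{N}$ and $R\subseteq\{1,\dots,m\}$. It is feasible if for every $(\rho,r,d)\in\mathcal{D}$ it contains an order $(t,R)$ with $\rho\in R$ and $r\le t\le d$. Its cost is the sum of $C+\sum_{\rho\in R}c_\rho$ over its orders $(t,R)$. Let $\mathrm{OPT}$ denote the minimum cost of a feasible schedule. Let $U$ be the maximum deadline and let $\mathrm{LP}$ denote the optimal value of the standard LP relaxation: $$\begin{aligned}\text{minimize}\quad & \sum_{t=1}^{U}\Bigl(C\,x_t+\sum_{\rho=1}^m c_\rho\,x^\rho_t\Bigr)\\ \text{subject to}\quad & x_t\ge x^\rho_t \quad (1\le t\le U,\ 1\le\rho\le m),\\ & \sum_{t=r}^{d}x^\rho_t\ge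 1\quad ((\rho,r,d)\in\mathcal{D}),\\ & x_t,\,x^\rho_t\ge 0\quad (1\le t\le U,\ 1\le\rho\le m).\end{aligned}$$ The integrality gap of the LP relaxation on a class of instances is the supremum of $\mathrm{OPT}/\mathrm{LP}$ over all instances in the class with $\mathrm{LP}>0$. Theorem. The integrality gap of the LP relaxation is (i) at least $\tfrac12(1+\sqrt2)\ge 1.207$ on the class of all instances, and (ii) at least $1.2$ on the class of instances in which all demand periods have equal length (that is, $d-r$ is the same for all demands). -/

import Mathlib

/-!
The Joint Replenishment Problem with Deadlines, its standard linear-programming relaxation,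
and the integrality gap of that relaxation.
-/

namespace JRPD

/-- A demand `(ρ, r, d)` of retailer `ρ` with release time `r` and deadline `d`. -/
abbrev Demand (m : ℕ) : Type := Fin m × ℕ × ℕ

namespace Demand

abbrev retailer {m : ℕ} (p : Demand m) : Fin m := p.1

abbrev release {m : ℕ} (p : Demand m) : ℕ := p.2.1

abbrev deadline {m : ℕ} (p : Demand m) : ℕ := p.2.2

end Demand

/-- An instance `(C, c, 𝒟)` with `m` retailers: rational nonnegative ordering costs and a finite
set of demands, whose periods are nonempty intervals of positive integer times. -/
structure Instance where
  m : ℕ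
  C : ℚ
  c : Fin m → ℚ
  demands : Finset (Demand m)
  C_nonneg : 0 ≤ C
  c_nonneg : ∀ ρ, 0 ≤ c ρ
  one_le_release : ∀ p ∈ demands, 1 ≤ p.release
  release_le_deadline : ∀ p ∈ demands, p.release ≤ p.deadline

namespace Instance

/-- The maximum deadline. -/
def maxDeadline (I : Instance) : ℕ := I.demands.sup Demand.deadline

/-- The universe of times `{1, …, maxDeadline}`. -/
def times (I : Instance) : Finset ℕ := Finset.Icc 1 I.maxDeadline

/-- A schedule is a finite set of orders `(t, R)`: the time and the participating retailers. -/
abbrev Schedule (I : Instance) : Type := Finset (ℕ × Finset (Fin I.m))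

/-- Every demand is satisfied by some order of the schedule. -/
def Schedule.Feasible {I : Instance} (S : I.Schedule) : Prop :=
  ∀ p ∈ I.demands, ∃ o ∈ S, p.retailer ∈ o.2 ∧ p.release ≤ o.1 ∧ o.1 ≤ p.deadline

/-- The sum of the costs `C + ∑ ρ ∈ R, c ρ` of the orders. -/
def Schedule.cost {I : Instance} (S : I.Schedule) : ℝ :=
  ∑ o ∈ S, ((I.C : ℝ) + ∑ ρ ∈ o.2, (I.c ρ : ℝ))

/-- The minimum cost of a feasible schedule. -/
noncomputable def opt (I : Instance) : ℝ :=
  sInf {v | ∃ S : I.Schedule, S.Feasible ∧ S.cost = v}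

/-- The constraints of the LP relaxation: `x t` is the amount of warehouse order at time `t`, and
`y ρ t` the amount of retailer `ρ`'s order at time `t`. Only the values at the times of the
universe matter. -/
structure FractionalFeasible (I : Instance) (x : ℕ → ℝ) (y : Fin I.m → ℕ → ℝ) : Prop where
  le_warehouse : ∀ t ∈ I.times, ∀ ρ, y ρ t ≤ x t
  satisfied : ∀ p ∈ I.demands, 1 ≤ ∑ t ∈ Finset.Icc p.release p.deadline, y p.retailer t
  warehouse_nonneg : ∀ t ∈ I.times, 0 ≤ x t
  retailer_nonneg : ∀ t ∈ I.times, ∀ ρ, 0 ≤ y ρ t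

/-- The objective function of the LP relaxation. -/
def fractionalCost (I : Instance) (x : ℕ → ℝ) (y : Fin I.m → ℕ → ℝ) : ℝ :=
  ∑ t ∈ I.times, ((I.C : ℝ) * x t + ∑ ρ, (I.c ρ : ℝ) * y ρ t)

/-- The optimal value of the LP relaxation. -/
noncomputable def lpOpt (I : Instance) : ℝ :=
  sInf {v | ∃ x y, I.FractionalFeasible x y ∧ I.fractionalCost x y = v}

/-- All demand periods have the same length. -/
def EqualLength (I : Instance) : Prop :=
  ∃ L : ℕ, ∀ p ∈ I.demands, p.deadline = p.release + L

/-! The two infima above are over nonempty sets of nonnegative reals. -/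

theorem Schedule.cost_nonneg {I : Instance} (S : I.Schedule) : 0 ≤ S.cost := by
  refine Finset.sum_nonneg fun o _ => add_nonneg (by exact_mod_cast I.C_nonneg) ?_
  exact Finset.sum_nonneg fun ρ _ => by exact_mod_cast I.c_nonneg ρ

theorem exists_feasible (I : Instance) : ∃ S : I.Schedule, S.Feasible :=
  ⟨I.demands.image fun p => (p.release, {p.retailer}), fun p hp =>
    ⟨_, Finset.mem_image_of_mem _ hp, by simp, le_rfl, I.release_le_deadline p hp⟩⟩

theorem fractionalCost_nonneg {I : Instance} {x : ℕ → ℝ} {y : Fin I.m → ℕ → ℝ}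
    (h : I.FractionalFeasible x y) : 0 ≤ I.fractionalCost x y := by
  refine Finset.sum_nonneg fun t ht => add_nonneg
    (mul_nonneg (by exact_mod_cast I.C_nonneg) (h.warehouse_nonneg t ht)) ?_
  exact Finset.sum_nonneg fun ρ _ =>
    mul_nonneg (by exact_mod_cast I.c_nonneg ρ) (h.retailer_nonneg t ht ρ)

theorem exists_fractionalFeasible (I : Instance) : ∃ x y, I.FractionalFeasible x y := by
  refine ⟨fun _ => 1, fun _ _ => 1, by simp, fun p hp => ?_, by simp, by simp⟩
  have := I.release_le_deadline p hp
  have h : 1 ≤ p.deadline + 1 - p.release := by omega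
  simpa using (by exact_mod_cast h : (1 : ℝ) ≤ ((p.deadline + 1 - p.release : ℕ) : ℝ))

end Instance

/-- The integrality gap of the LP relaxation on a class `P` of instances: the supremum of the
ratios of the integral to the fractional optimum, over the instances in `P` for which the
fractional optimum is positive. -/
noncomputable def integralityGap (P : Set Instance) : EReal :=
  ⨆ (I : Instance) (_ : I ∈ P) (_ : 0 < I.lpOpt), ((I.opt / I.lpOpt : ℝ) : EReal)

end JRPD

/-!
Both bounds come from instances with two retailers, warehouse cost `1`, and retailer costs `0`
and `c`.  The first retailer's demands force warehouse orders to be frequent, and the second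
retailer's demands force it to order less often, by a factor `μ` strictly between `1` and `2`.
Between two consecutive orders of the second retailer, an integral schedule faces a dilemma: either the two
orders are close together, and `c` is paid too often, or they are far apart, and an additional
warehouse order has to be placed between them.  A fractional solution avoids both losses.

Integral schedules are bounded from below by a potential argument (`potential_le_opt`): a
nondecreasing function `φ` of time that grows by at most `1 + c` until the first retailer has to be
served again, and by at most `2 + c` until the second one has to, grows by at most the cost of a
feasible schedule.

For the class of all instances, the demand periods are all windows of `a` (first retailer) or `b`
(second retailer) consecutive times, the fractional solution is uniform, and the potential is
linear in time.  With `c = (2a - b) / (b - a)` the two cases of the dilemma are equally expensive,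
and the gap is `μ / (μ² - 2μ + 2)` for `μ = b / a`, in the limit of a long horizon
(`windowRatio_le_integralityGap`).  This is maximal at `μ = √2`, where it equals `(1 + √2) / 2`.

For periods of equal length, the idea is used with `μ = 3/2` and `c = 1`, where the bound is `6/5`.
The demand periods are `[2k, 2k + 3]` for the first retailer and `[3k, 3k + 3]` for the second one.
The fractional solution has warehouse orders of `1/2` at the times congruent to `0`, `3`, `4`
modulo `6`, and orders of `1/2` of the second retailer at the multiples of `3`, hence costs `5/2`
in six units of time; the potential `⌊t / 2⌋` grows by `3`.
-/

namespace JRPD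

open Filter Topology

/-! ### Bounds for the two optima -/

theorem lpOpt_le {I : Instance} {x : ℕ → ℝ} {y : Fin I.m → ℕ → ℝ}
    (h : I.FractionalFeasible x y) : I.lpOpt ≤ I.fractionalCost x y := by
  refine csInf_le ⟨0, ?_⟩ ⟨x, y, h, rfl⟩
  rintro _ ⟨x', y', h', rfl⟩
  exact Instance.fractionalCost_nonneg h'

theorem le_opt {I : Instance} {A : ℝ}
    (h : ∀ S : I.Schedule, S.Feasible → A ≤ S.cost) : A ≤ I.opt := by
  obtain ⟨S, hS⟩ := I.exists_feasible
  refine le_csInf ⟨_, S, hS, rfl⟩ ?_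
  rintro _ ⟨S', hS', rfl⟩
  exact h S' hS'

/-- Already a single demand forces a total warehouse order of at least `1`. -/
theorem warehouseCost_le_lpOpt {I : Instance} (h : I.demands.Nonempty) : (I.C : ℝ) ≤ I.lpOpt := by
  obtain ⟨x₀, y₀, h₀⟩ := I.exists_fractionalFeasible
  refine le_csInf ⟨_, x₀, y₀, h₀, rfl⟩ ?_
  rintro _ ⟨x, y, hxy, rfl⟩
  obtain ⟨p, hp⟩ := h
  have hC : (0 : ℝ) ≤ I.C := by exact_mod_cast I.C_nonneg
  have hsub : Finset.Icc p.release p.deadline ⊆ I.times :=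
    Finset.Icc_subset_Icc (I.one_le_release p hp) (Finset.le_sup (f := Demand.deadline) hp)
  have hx : 1 ≤ ∑ t ∈ I.times, x t :=
    calc (1 : ℝ) ≤ ∑ t ∈ Finset.Icc p.release p.deadline, y p.retailer t := hxy.satisfied p hp
      _ ≤ ∑ t ∈ Finset.Icc p.release p.deadline, x t :=
        Finset.sum_le_sum fun t ht => hxy.le_warehouse t (hsub ht) _
      _ ≤ ∑ t ∈ I.times, x t :=
        Finset.sum_le_sum_of_subset_of_nonneg hsub fun t ht _ => hxy.warehouse_nonneg t ht
  calc (I.C : ℝ) ≤ I.C * ∑ t ∈ I.times, x t := le_mul_of_one_le_right hC hx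
    _ = ∑ t ∈ I.times, (I.C : ℝ) * x t := Finset.mul_sum _ _ _
    _ ≤ I.fractionalCost x y := by
      refine Finset.sum_le_sum fun t ht => le_add_of_nonneg_right ?_
      exact Finset.sum_nonneg fun ρ _ =>
        mul_nonneg (by exact_mod_cast I.c_nonneg ρ) (hxy.retailer_nonneg t ht ρ)

theorem div_le_integralityGap {P : Set Instance} {I : Instance} (hI : I ∈ P) {A B : ℝ}
    (hA : 0 ≤ A) (hAopt : A ≤ I.opt) (hlp : 0 < I.lpOpt) (hlpB : I.lpOpt ≤ B) :
    ((A / B : ℝ) : EReal) ≤ integralityGap P := by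
  refine le_trans (EReal.coe_le_coe_iff.2 ?_)
    (le_iSup_of_le I (le_iSup_of_le hI (le_iSup_of_le hlp le_rfl)))
  exact div_le_div₀ (hA.trans hAopt) hAopt hlp hlpB

/-! ### Instances with two retailers -/

/-- The instance with warehouse cost `1` and two retailers: one with ordering cost `0` and demand
periods `D₀`, the other with ordering cost `c` and demand periods `D₁`. A pair `(r, d)` in `D₀` or
`D₁` stands for the period `[r, d]`. -/
def twoRetailers (c : ℚ) (hc : 0 ≤ c) (D₀ D₁ : Finset (ℕ × ℕ))
    (h₀ : ∀ p ∈ D₀, 1 ≤ p.1 ∧ p.1 ≤ p.2) (h₁ : ∀ p ∈ D₁, 1 ≤ p.1 ∧ p.1 ≤ p.2) : Instance where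
  m := 2
  C := 1
  c := ![0, c]
  demands := ({0} ×ˢ D₀) ∪ ({1} ×ˢ D₁)
  C_nonneg := zero_le_one
  c_nonneg := by
    intro ρ
    fin_cases ρ
    · exact le_rfl
    · exact hc
  one_le_release := by
    rintro ⟨ρ, p⟩ hp
    simp only [Finset.mem_union, Finset.mem_product] at hp
    rcases hp with hp | hp
    · exact (h₀ p hp.2).1
    · exact (h₁ p hp.2).1
  release_le_deadline := by
    rintro ⟨ρ, p⟩ hp
    simp only [Finset.mem_union, Finset.mem_product] at hp
    rcases hp with hp | hp
    · exact (h₀ p hp.2).2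
    · exact (h₁ p hp.2).2

section TwoRetailers

variable {c : ℚ} {hc : 0 ≤ c} {D₀ D₁ : Finset (ℕ × ℕ)}
  {h₀ : ∀ p ∈ D₀, 1 ≤ p.1 ∧ p.1 ≤ p.2} {h₁ : ∀ p ∈ D₁, 1 ≤ p.1 ∧ p.1 ≤ p.2}

theorem forall_mem_twoRetailers_demands {Q : Demand 2 → Prop} :
    (∀ p ∈ (twoRetailers c hc D₀ D₁ h₀ h₁).demands, Q p) ↔
      (∀ p ∈ D₀, Q (0, p)) ∧ ∀ p ∈ D₁, Q (1, p) := by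
  change (∀ p ∈ ({0} ×ˢ D₀) ∪ ({1} ×ˢ D₁), Q p) ↔ _
  constructor
  · intro h
    exact ⟨fun p hp => h (0, p) (by simp [hp]), fun p hp => h (1, p) (by simp [hp])⟩
  · rintro ⟨hQ₀, hQ₁⟩ ⟨ρ, p⟩ hp
    simp only [Finset.mem_union, Finset.mem_product, Finset.mem_singleton] at hp
    rcases hp with ⟨rfl, hp⟩ | ⟨rfl, hp⟩
    · exact hQ₀ p hp
    · exact hQ₁ p hp

theorem twoRetailers_fractionalCost (x : ℕ → ℝ) (y : Fin 2 → ℕ → ℝ) :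
    (twoRetailers c hc D₀ D₁ h₀ h₁).fractionalCost x y =
      ∑ t ∈ (twoRetailers c hc D₀ D₁ h₀ h₁).times, (x t + c * y 1 t) := by
  refine Finset.sum_congr rfl fun t _ => ?_
  change ((1 : ℚ) : ℝ) * x t + ∑ ρ : Fin 2, ((![0, c] ρ : ℚ) : ℝ) * y ρ t = _
  simp [Fin.sum_univ_two]

theorem twoRetailers_times_subset {K : ℕ} (hK₀ : ∀ p ∈ D₀, p.2 ≤ K) (hK₁ : ∀ p ∈ D₁, p.2 ≤ K) :
    (twoRetailers c hc D₀ D₁ h₀ h₁).times ⊆ Finset.Icc 1 K :=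
  Finset.Icc_subset_Icc le_rfl
    (Finset.sup_le (forall_mem_twoRetailers_demands.2 ⟨hK₀, hK₁⟩))

theorem twoRetailers_lpOpt_pos (h : D₀.Nonempty) :
    0 < (twoRetailers c hc D₀ D₁ h₀ h₁).lpOpt := by
  obtain ⟨p, hp⟩ := h
  have := warehouseCost_le_lpOpt (I := twoRetailers c hc D₀ D₁ h₀ h₁)
    ⟨((0 : Fin 2), p), Finset.mem_union_left _
      (Finset.mem_product.2 ⟨Finset.mem_singleton_self _, hp⟩)⟩
  refine lt_of_lt_of_le ?_ this
  simp [twoRetailers]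

/-- The first retailer has cost `0`, so it can take part in all warehouse orders `x` of a
fractional solution, and only the orders `z` of the second retailer remain to be chosen. -/
theorem twoRetailers_lpOpt_le {K : ℕ} (hK₀ : ∀ p ∈ D₀, p.2 ≤ K) (hK₁ : ∀ p ∈ D₁, p.2 ≤ K)
    {x z : ℕ → ℝ} (hz : ∀ t, 0 ≤ z t) (hzx : ∀ t, z t ≤ x t)
    (hx₀ : ∀ p ∈ D₀, 1 ≤ ∑ t ∈ Finset.Icc p.1 p.2, x t)
    (hz₁ : ∀ p ∈ D₁, 1 ≤ ∑ t ∈ Finset.Icc p.1 p.2, z t) :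
    (twoRetailers c hc D₀ D₁ h₀ h₁).lpOpt ≤ ∑ t ∈ Finset.Icc 1 K, (x t + c * z t) := by
  have hfeas : (twoRetailers c hc D₀ D₁ h₀ h₁).FractionalFeasible x
      (![x, z] : Fin 2 → ℕ → ℝ) := by
    refine ⟨fun t _ => ?_, ?_, fun t _ => (hz t).trans (hzx t), fun t _ => ?_⟩
    · exact (Fin.forall_fin_two (p := fun ρ => (![x, z] : Fin 2 → ℕ → ℝ) ρ t ≤ x t)).2
        ⟨le_rfl, hzx t⟩
    · exact forall_mem_twoRetailers_demands.2 ⟨hx₀, hz₁⟩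
    · exact (Fin.forall_fin_two (p := fun ρ => 0 ≤ (![x, z] : Fin 2 → ℕ → ℝ) ρ t)).2
        ⟨(hz t).trans (hzx t), hz t⟩
  refine (lpOpt_le hfeas).trans ?_
  rw [twoRetailers_fractionalCost]
  have hc' : (0 : ℝ) ≤ c := by exact_mod_cast hc
  exact Finset.sum_le_sum_of_subset_of_nonneg (twoRetailers_times_subset hK₀ hK₁) fun t _ _ =>
    add_nonneg ((hz t).trans (hzx t)) (mul_nonneg hc' (hz t))

/-- The potential bound. Suppose that after any time `u < M` the first retailer has to be served
before the potential `φ` has grown by more than `1 + c`, and the second retailer before it has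
grown by more than `2 + c`. Then any feasible schedule costs at least the growth of `φ` up to time
`M`. -/
theorem potential_le_opt {φ : ℕ → ℝ} (hφ : Monotone φ) {M : ℕ}
    (hD₀ : ∀ u < M, ∃ p ∈ D₀, u < p.1 ∧ φ p.2 ≤ φ u + (1 + c))
    (hD₁ : ∀ u < M, ∃ p ∈ D₁, u < p.1 ∧ φ p.2 ≤ φ u + (2 + c)) :
    φ M - φ 0 ≤ (twoRetailers c hc D₀ D₁ h₀ h₁).opt := by
  refine le_opt fun S hS => ?_
  obtain ⟨hS₀, hS₁⟩ := forall_mem_twoRetailers_demands.1 hS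
  have hc' : (0 : ℝ) ≤ c := by exact_mod_cast hc
  set w : ℕ × Finset (Fin 2) → ℝ := fun o => 1 + ∑ ρ ∈ o.2, ((![0, c] ρ : ℚ) : ℝ) with hw
  have hcn : ∀ ρ : Fin 2, (0 : ℝ) ≤ ((![0, c] ρ : ℚ) : ℝ) := by
    rw [Fin.forall_fin_two]
    simpa using hc
  have hw1 : ∀ o, 1 ≤ w o := fun o =>
    le_add_of_nonneg_right (Finset.sum_nonneg fun ρ _ => hcn ρ)
  have hw0 : ∀ o, 0 ≤ w o := fun o => zero_le_one.trans (hw1 o)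
  have hwc : ∀ o : ℕ × Finset (Fin 2), (1 : Fin 2) ∈ o.2 → 1 + (c : ℝ) ≤ w o := by
    intro o ho
    have := Finset.single_le_sum (f := fun ρ : Fin 2 => ((![0, c] ρ : ℚ) : ℝ))
      (fun ρ _ => hcn ρ) ho
    simpa [hw] using this
  have hcost : S.cost = ∑ o ∈ S, w o := by
    refine Finset.sum_congr rfl fun o _ => ?_
    change ((1 : ℚ) : ℝ) + _ = _
    rw [Rat.cast_one]
    rfl
  -- Backward induction on `u`: the orders after time `u` pay for the growth of `φ` after `u`.
  have key : ∀ k u, M ≤ u + k → φ M - φ u ≤ ∑ o ∈ S with u < o.1, w o := by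
    intro k
    induction k with
    | zero =>
      intro u hu
      exact (sub_nonpos.2 (hφ hu)).trans (Finset.sum_nonneg fun o _ => hw0 o)
    | succ k ih =>
      intro u hu
      rcases le_or_gt M u with hMu | huM
      · exact (sub_nonpos.2 (hφ hMu)).trans (Finset.sum_nonneg fun o _ => hw0 o)
      obtain ⟨p, hp, hup, hφp⟩ := hD₁ u huM
      obtain ⟨o, hoS, ho1, hpo, hop⟩ := hS₁ p hp
      change (1 : Fin 2) ∈ o.2 at ho1
      change p.1 ≤ o.1 at hpo
      change o.1 ≤ p.2 at hop
      have hrest := ih o.1 (by omega)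
      have hoc := hwc o ho1
      have hnot : o ∉ S.filter fun o' => o.1 < o'.1 := by simp
      rcases le_or_gt (φ o.1) (φ u + (1 + c)) with hnear | hfar
      · have hsub : insert o (S.filter fun o' => o.1 < o'.1) ⊆ S.filter fun o' => u < o'.1 := by
          intro o' ho'
          rcases Finset.mem_insert.1 ho' with rfl | ho'
          · exact Finset.mem_filter.2 ⟨hoS, by omega⟩
          · rw [Finset.mem_filter] at ho' ⊢
            exact ⟨ho'.1, by omega⟩
        have := Finset.sum_le_sum_of_subset_of_nonneg hsub fun o' _ _ => hw0 o'
        rw [Finset.sum_insert hnot] at this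
        linarith
      -- The next order of the second retailer is late, so the first retailer is served before it.
      · obtain ⟨q, hq, huq, hφq⟩ := hD₀ u huM
        obtain ⟨e, heS, -, hqe, heq⟩ := hS₀ q hq
        change q.1 ≤ e.1 at hqe
        change e.1 ≤ q.2 at heq
        have heo : e.1 < o.1 := by
          by_contra hcon
          have := hφ ((not_lt.1 hcon).trans heq)
          linarith
        have hnot' : e ∉ insert o (S.filter fun o' => o.1 < o'.1) := by
          simp only [Finset.mem_insert, Finset.mem_filter, not_or]
          refine ⟨fun h => ?_, fun h => by omega⟩
          rw [h] at heo
          omega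
        have hsub : insert e (insert o (S.filter fun o' => o.1 < o'.1)) ⊆
            S.filter fun o' => u < o'.1 := by
          intro o' ho'
          rcases Finset.mem_insert.1 ho' with rfl | ho'
          · exact Finset.mem_filter.2 ⟨heS, by omega⟩
          rcases Finset.mem_insert.1 ho' with rfl | ho'
          · exact Finset.mem_filter.2 ⟨hoS, by omega⟩
          · rw [Finset.mem_filter] at ho' ⊢
            exact ⟨ho'.1, by omega⟩
        have := Finset.sum_le_sum_of_subset_of_nonneg hsub fun o' _ _ => hw0 o'
        rw [Finset.sum_insert hnot', Finset.sum_insert hnot] at this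
        have := hw1 e
        have := hφ hop
        linarith
  rw [hcost]
  exact (key M 0 (by omega)).trans
    (Finset.sum_le_sum_of_subset_of_nonneg (Finset.filter_subset _ _) fun o _ _ => hw0 o)

end TwoRetailers

/-! ### Windows of two lengths -/

/-- The windows of `a` consecutive times that start in `{1, …, N}`, for `1 ≤ a`. -/
def windows (a N : ℕ) : Finset (ℕ × ℕ) := (Finset.Icc 1 N).image fun k => (k, k + a - 1)

theorem mem_windows {a N : ℕ} {p : ℕ × ℕ} :
    p ∈ windows a N ↔ (1 ≤ p.1 ∧ p.1 ≤ N) ∧ p.2 = p.1 + a - 1 := by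
  obtain ⟨r, d⟩ := p
  simp only [windows, Finset.mem_image, Finset.mem_Icc, Prod.mk.injEq]
  constructor
  · rintro ⟨k, hk, rfl, rfl⟩
    exact ⟨hk, rfl⟩
  · rintro ⟨hk, rfl⟩
    exact ⟨r, hk, rfl, rfl⟩

theorem windows_valid {a N : ℕ} (ha : 0 < a) : ∀ p ∈ windows a N, 1 ≤ p.1 ∧ p.1 ≤ p.2 := by
  intro p hp
  rw [mem_windows] at hp
  omega

theorem sum_window {a N : ℕ} (ha : 0 < a) {p : ℕ × ℕ} (hp : p ∈ windows a N) :
    ∑ _t ∈ Finset.Icc p.1 p.2, (1 / a : ℝ) = 1 := by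
  rw [mem_windows] at hp
  have hcard : p.2 + 1 - p.1 = a := by omega
  have : (a : ℝ) ≠ 0 := by exact_mod_cast ha.ne'
  rw [Finset.sum_const, Nat.card_Icc, hcard, nsmul_eq_mul, mul_one_div_cancel this]

/-- The ratio for windows of `a` and `b` times, with the horizon `N`: the potential `t / (b - a)`
is compared with the uniform fractional solution. -/
theorem windowRatio_horizon_le_integralityGap {a b : ℕ} (hab : a < b) (hba : b < 2 * a) {N : ℕ}
    (hN : 0 < N) :
    ((((a * b / (b ^ 2 - 2 * a * b + 2 * a ^ 2) : ℝ) * (N / (N + b)) : ℝ)) : EReal) ≤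
      integralityGap Set.univ := by
  have ha : 0 < a := by omega
  have hb : 0 < b := by omega
  have hQ : (0 : ℚ) < b - a := sub_pos.2 (by exact_mod_cast hab)
  have hR : (0 : ℝ) < b - a := sub_pos.2 (by exact_mod_cast hab)
  have haR : (0 : ℝ) < a := by exact_mod_cast ha
  have hbR : (0 : ℝ) < b := by exact_mod_cast hb
  have hNR : (0 : ℝ) < N := by exact_mod_cast hN
  have hc : (0 : ℚ) ≤ (2 * a - b) / (b - a) :=
    div_nonneg (sub_nonneg.2 (by exact_mod_cast hba.le)) hQ.le
  -- This cost makes `(1 + c) / a` and `(2 + c) / b` both equal to `1 / (b - a)`.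
  set c : ℚ := (2 * a - b) / (b - a) with hcdef
  have hcR : (c : ℝ) = (2 * a - b) / (b - a) := by rw [hcdef]; push_cast; rfl
  have h1c : 1 + (c : ℝ) = a / (b - a) := by rw [hcR]; field_simp; ring
  have h2c : 2 + (c : ℝ) = b / (b - a) := by rw [hcR]; field_simp; ring
  have hopt : (N : ℝ) / (b - a) ≤ (twoRetailers c hc (windows a N) (windows b N)
      (windows_valid ha) (windows_valid hb)).opt := by
    have hφ : Monotone fun t : ℕ => (t : ℝ) / (b - a) := fun s t hst =>
      div_le_div_of_nonneg_right (by exact_mod_cast hst) hR.le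
    refine le_trans (le_of_eq ?_) (potential_le_opt hφ (M := N) ?_ ?_)
    · simp
    · intro u hu
      refine ⟨(u + 1, u + a), mem_windows.2 ⟨⟨by omega, hu⟩, by simp only; omega⟩,
        Nat.lt_succ_self u, ?_⟩
      simp only [h1c, ← add_div]
      push_cast
      exact le_rfl
    · intro u hu
      refine ⟨(u + 1, u + b), mem_windows.2 ⟨⟨by omega, hu⟩, by simp only; omega⟩,
        Nat.lt_succ_self u, ?_⟩
      simp only [h2c, ← add_div]
      push_cast
      exact le_rfl
  have hlp : (twoRetailers c hc (windows a N) (windows b N)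
      (windows_valid ha) (windows_valid hb)).lpOpt ≤ (N + b) * (1 / a + c * (1 / b)) := by
    refine (twoRetailers_lpOpt_le (K := N + b) (x := fun _ => 1 / a) (z := fun _ => 1 / b)
      ?_ ?_ ?_ ?_ ?_ ?_).trans (le_of_eq ?_)
    · intro p hp
      rw [mem_windows] at hp
      omega
    · intro p hp
      rw [mem_windows] at hp
      omega
    · intro t
      positivity
    · intro t
      exact one_div_le_one_div_of_le haR (by exact_mod_cast hab.le)
    · exact fun p hp => (sum_window ha hp).ge
    · exact fun p hp => (sum_window hb hp).ge
    · simp [mul_add]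
  have hpos : 0 < (twoRetailers c hc (windows a N) (windows b N)
      (windows_valid ha) (windows_valid hb)).lpOpt :=
    twoRetailers_lpOpt_pos ⟨(1, 1 + a - 1), mem_windows.2 ⟨⟨le_rfl, hN⟩, rfl⟩⟩
  have h := div_le_integralityGap (Set.mem_univ _) (by positivity) hopt hpos hlp
  convert h using 2
  have hden : (b : ℝ) ^ 2 - 2 * a * b + 2 * a ^ 2 ≠ 0 := by nlinarith
  have hsum : 1 / (a : ℝ) + c * (1 / b) =
      (b ^ 2 - 2 * a * b + 2 * a ^ 2) / (a * b * (b - a)) := by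
    rw [hcR]
    field_simp
    ring
  have hNb : (N : ℝ) + b ≠ 0 := by positivity
  rw [hsum]
  field_simp

/-- The ratio for windows whose lengths have the quotient `μ`, in the limit of a long horizon. -/
theorem windowRatio_le_integralityGap {μ : ℚ} (h1 : 1 < μ) (h2 : μ < 2) :
    (((μ / (μ ^ 2 - 2 * μ + 2) : ℝ)) : EReal) ≤ integralityGap Set.univ := by
  obtain ⟨b, hb⟩ : ∃ b : ℕ, μ.num = b :=
    Int.eq_ofNat_of_zero_le (Rat.num_nonneg.2 (zero_le_one.trans h1.le))
  have hdQ : (0 : ℚ) < μ.den := by exact_mod_cast μ.den_pos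
  have hμ : μ = b / μ.den := by
    conv_lhs => rw [← Rat.num_div_den μ, hb]
    simp
  have hab : μ.den < b := by
    rw [hμ, one_lt_div hdQ] at h1
    exact_mod_cast h1
  have hba : b < 2 * μ.den := by
    rw [hμ, div_lt_iff₀ hdQ] at h2
    exact_mod_cast h2
  have hdR : (μ.den : ℝ) ≠ 0 := by exact_mod_cast μ.den_nz
  have hμR : (μ : ℝ) = b / μ.den := by
    simpa using congrArg (Rat.cast : ℚ → ℝ) hμ
  have hratio : (μ / (μ ^ 2 - 2 * μ + 2) : ℝ) =
      μ.den * b / (b ^ 2 - 2 * μ.den * b + 2 * μ.den ^ 2) := by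
    have hden : (b : ℝ) ^ 2 - 2 * μ.den * b + 2 * μ.den ^ 2 ≠ 0 := by
      have : (0 : ℝ) < μ.den := by exact_mod_cast μ.den_pos
      nlinarith [sq_nonneg ((b : ℝ) - μ.den), pow_pos this 2]
    have hden' : (μ : ℝ) ^ 2 - 2 * μ + 2 ≠ 0 := by nlinarith [sq_nonneg ((μ : ℝ) - 1)]
    rw [div_eq_div_iff hden' hden, hμR]
    field_simp
  rw [hratio]
  refine le_of_tendsto (((continuous_coe_real_ereal.tendsto _).comp
    ((tendsto_natCast_div_add_atTop (b : ℝ)).const_mul _)).trans ?_)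
    ((eventually_gt_atTop 0).mono fun N hN => windowRatio_horizon_le_integralityGap hab hba hN)
  rw [mul_one]

/-! ### Periods of equal length -/

/-- The periods `[s k, s k + 3]` for `k ∈ {1, …, n}`. -/
def multiples (s n : ℕ) : Finset (ℕ × ℕ) := (Finset.Icc 1 n).image fun k => (s * k, s * k + 3)

theorem mem_multiples {s n : ℕ} {p : ℕ × ℕ} :
    p ∈ multiples s n ↔ ∃ k, (1 ≤ k ∧ k ≤ n) ∧ p = (s * k, s * k + 3) := by
  simp only [multiples, Finset.mem_image, Finset.mem_Icc, eq_comm]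

theorem multiples_valid {s n : ℕ} (hs : 0 < s) :
    ∀ p ∈ multiples s n, 1 ≤ p.1 ∧ p.1 ≤ p.2 := by
  intro p hp
  obtain ⟨k, ⟨hk, -⟩, rfl⟩ := mem_multiples.1 hp
  exact ⟨Nat.mul_pos hs hk, Nat.le_add_right _ _⟩

/-- The fractional warehouse orders of the instance with periods of length `3`. -/
noncomputable def halfWarehouse (t : ℕ) : ℝ :=
  if t % 6 = 0 ∨ t % 6 = 3 ∨ t % 6 = 4 then 1 / 2 else 0

/-- The fractional orders of the second retailer in the instance with periods of length `3`. -/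
noncomputable def halfRetailer (t : ℕ) : ℝ := if t % 3 = 0 then 1 / 2 else 0

theorem halfRetailer_nonneg (t : ℕ) : 0 ≤ halfRetailer t := by
  unfold halfRetailer
  split_ifs <;> norm_num

theorem halfRetailer_le_halfWarehouse (t : ℕ) : halfRetailer t ≤ halfWarehouse t := by
  unfold halfRetailer halfWarehouse
  split_ifs <;> first | omega | norm_num

theorem sum_Icc_add_three (f : ℕ → ℝ) (r : ℕ) :
    ∑ t ∈ Finset.Icc r (r + 3), f t = f r + f (r + 1) + f (r + 2) + f (r + 3) := by
  simp [Finset.sum_Icc_succ_top, add_assoc]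

theorem one_le_sum_halfWarehouse (k : ℕ) :
    1 ≤ ∑ t ∈ Finset.Icc (2 * k) (2 * k + 3), halfWarehouse t := by
  rw [sum_Icc_add_three]
  unfold halfWarehouse
  split_ifs <;> first | omega | norm_num

theorem one_le_sum_halfRetailer (k : ℕ) :
    1 ≤ ∑ t ∈ Finset.Icc (3 * k) (3 * k + 3), halfRetailer t := by
  rw [sum_Icc_add_three]
  unfold halfRetailer
  split_ifs <;> first | omega | norm_num

theorem sum_range_six_mul (n : ℕ) :
    ∑ t ∈ Finset.range (6 * n), (halfWarehouse t + halfRetailer t) = 5 / 2 * n := by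
  induction n with
  | zero => simp
  | succ n ih =>
    have hW : ∀ i, halfWarehouse (6 * n + i) = halfWarehouse i := fun i => by
      simp [halfWarehouse]
    have hR : ∀ i, halfRetailer (6 * n + i) = halfRetailer i := fun i => by
      have : (6 * n + i) % 3 = i % 3 := by omega
      simp [halfRetailer, this]
    rw [Nat.mul_succ, Finset.sum_range_add, ih]
    simp only [hW, hR, Finset.sum_range_succ, Finset.sum_range_zero]
    norm_num [halfWarehouse, halfRetailer]
    ring

/-- The ratio for the periods of length `3`, with the horizon `6 n`: the potential `⌊t / 2⌋`, which
has the value `3 n` at the time `6 n`, is compared with the half-integral solution, whose cost is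
bounded by its cost in `n + 1` stretches of six units of time. -/
theorem equalLengthRatio_le_integralityGap {n : ℕ} (hn : 0 < n) :
    (((6 / 5 : ℝ) * (n / (n + 1)) : ℝ) : EReal) ≤ integralityGap {I | I.EqualLength} := by
  have hopt : (3 * n : ℝ) ≤ (twoRetailers 1 zero_le_one (multiples 2 (3 * n))
      (multiples 3 (2 * n)) (multiples_valid two_pos) (multiples_valid three_pos)).opt := by
    have hφ : Monotone fun t : ℕ => ((t / 2 : ℕ) : ℝ) := fun s t hst =>
      Nat.cast_le.2 (Nat.div_le_div_right hst)
    refine le_trans (le_of_eq ?_) (potential_le_opt hφ (M := 6 * n) ?_ ?_)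
    · have : 6 * n / 2 = 3 * n := by omega
      simp [this]
    · intro u hu
      refine ⟨(2 * (u / 2 + 1), 2 * (u / 2 + 1) + 3),
        mem_multiples.2 ⟨u / 2 + 1, by omega, rfl⟩, by simp only; omega, ?_⟩
      have : (2 * (u / 2 + 1) + 3) / 2 ≤ u / 2 + 2 := by omega
      have : (((2 * (u / 2 + 1) + 3) / 2 : ℕ) : ℝ) ≤ ((u / 2 + 2 : ℕ) : ℝ) := Nat.cast_le.2 this
      norm_num at this ⊢
      linarith
    · intro u hu
      refine ⟨(3 * (u / 3 + 1), 3 * (u / 3 + 1) + 3),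
        mem_multiples.2 ⟨u / 3 + 1, by omega, rfl⟩, by simp only; omega, ?_⟩
      have : (3 * (u / 3 + 1) + 3) / 2 ≤ u / 2 + 3 := by omega
      have : (((3 * (u / 3 + 1) + 3) / 2 : ℕ) : ℝ) ≤ ((u / 2 + 3 : ℕ) : ℝ) := Nat.cast_le.2 this
      norm_num at this ⊢
      linarith
  have hlp : (twoRetailers 1 zero_le_one (multiples 2 (3 * n)) (multiples 3 (2 * n))
      (multiples_valid two_pos) (multiples_valid three_pos)).lpOpt ≤ 5 / 2 * (n + 1 : ℕ) := by
    refine (twoRetailers_lpOpt_le (K := 6 * n + 3) (x := halfWarehouse) (z := halfRetailer)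
      ?_ ?_ halfRetailer_nonneg halfRetailer_le_halfWarehouse ?_ ?_).trans ?_
    · intro p hp
      obtain ⟨k, hk, rfl⟩ := mem_multiples.1 hp
      simp only
      omega
    · intro p hp
      obtain ⟨k, hk, rfl⟩ := mem_multiples.1 hp
      simp only
      omega
    · intro p hp
      obtain ⟨k, -, rfl⟩ := mem_multiples.1 hp
      exact one_le_sum_halfWarehouse k
    · intro p hp
      obtain ⟨k, -, rfl⟩ := mem_multiples.1 hp
      exact one_le_sum_halfRetailer k
    · rw [← sum_range_six_mul]
      simp only [Rat.cast_one, one_mul]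
      refine Finset.sum_le_sum_of_subset_of_nonneg (fun t ht => ?_) fun t _ _ =>
        add_nonneg ((halfRetailer_nonneg t).trans (halfRetailer_le_halfWarehouse t))
          (halfRetailer_nonneg t)
      rw [Finset.mem_Icc] at ht
      rw [Finset.mem_range]
      omega
  have hpos : 0 < (twoRetailers 1 zero_le_one (multiples 2 (3 * n)) (multiples 3 (2 * n))
      (multiples_valid two_pos) (multiples_valid three_pos)).lpOpt :=
    twoRetailers_lpOpt_pos ⟨_, mem_multiples.2 ⟨1, by omega, rfl⟩⟩
  have hmem : twoRetailers 1 zero_le_one (multiples 2 (3 * n)) (multiples 3 (2 * n))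
      (multiples_valid two_pos) (multiples_valid three_pos) ∈ {I : Instance | I.EqualLength} := by
    refine ⟨3, forall_mem_twoRetailers_demands.2 ⟨fun p hp => ?_, fun p hp => ?_⟩⟩ <;>
    · obtain ⟨k, -, rfl⟩ := mem_multiples.1 hp
      rfl
  have h := div_le_integralityGap hmem (by positivity) hopt hpos hlp
  convert h using 2
  push_cast
  field_simp
  norm_num

end JRPD

open Filter Topology in
theorem mainTheorem6 :
    ((((1 + Real.sqrt 2) / 2 : ℝ) : EReal) ≤ JRPD.integralityGap Set.univ ∧
      (1.207 : ℝ) ≤ (1 + Real.sqrt 2) / 2) ∧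
    ((1.2 : ℝ) : EReal) ≤ JRPD.integralityGap {I | I.EqualLength} := by
  have hsq : Real.sqrt 2 ^ 2 = 2 := Real.sq_sqrt zero_le_two
  have hlow : (1.414 : ℝ) ≤ Real.sqrt 2 := Real.le_sqrt_of_sq_le (by norm_num)
  have hupp : Real.sqrt 2 < 2 := by nlinarith
  refine ⟨⟨?_, by linarith⟩, ?_⟩
  · obtain ⟨u, -, hu, hlim⟩ := Real.exists_seq_rat_strictMono_tendsto (Real.sqrt 2)
    have hden : Real.sqrt 2 ^ 2 - 2 * Real.sqrt 2 + 2 ≠ 0 := by nlinarith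
    have hval : (1 + Real.sqrt 2) / 2 =
        Real.sqrt 2 / (Real.sqrt 2 ^ 2 - 2 * Real.sqrt 2 + 2) := by
      rw [div_eq_div_iff two_ne_zero hden]
      nlinarith
    have hratio : Tendsto (fun n => (u n : ℝ) / ((u n : ℝ) ^ 2 - 2 * u n + 2)) atTop
        (𝓝 ((1 + Real.sqrt 2) / 2)) := by
      rw [hval]
      exact hlim.div (((hlim.pow 2).sub (hlim.const_mul 2)).add_const 2) hden
    refine le_of_tendsto ((continuous_coe_real_ereal.tendsto _).comp hratio) ?_
    filter_upwards [hlim.eventually_const_lt (show (1 : ℝ) < Real.sqrt 2 by linarith)] with n hn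
    exact JRPD.windowRatio_le_integralityGap (by exact_mod_cast hn)
      (by exact_mod_cast (hu n).trans hupp)
  · have hlim : Tendsto (fun n : ℕ => (6 / 5 : ℝ) * ((n : ℝ) / (n + 1))) atTop (𝓝 1.2) := by
      have := (tendsto_natCast_div_add_atTop (1 : ℝ)).const_mul (6 / 5)
      norm_num at this ⊢
      exact this
    exact le_of_tendsto ((continuous_coe_real_ereal.tendsto _).comp hlim)
      ((eventually_gt_atTop 0).mono fun n hn => JRPD.equalLengthRatio_le_integralityGap hn)
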